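/- Let $C(t)=\sum_{k=1}^N |a_k|^2 e^{i\omega_k t}$ be a signal with pairwise distinct real frequencies $\omega_k$ and $a_k\neq 0$. Let $T,W>0$, let $\omega^*\in\mathbb R$, and let $(f_l)_{l\ge1}$ be a $WT$-filter system: the $f_l\in L^2(\mathbb R)$ vanish outside $[-T,T]$, and their Fourier transforms $F_l(\omega)=\int f_l(t)e^{-i\omega t}\,dt$ form a complete Chebyshev system on $[-W,W]$, i.e. $\det(F_j(w_i))_{i,j\le n}\neq0$ for every $n$ and all distinct $w_1,\dots,w_n\in[-W,W]$. Put $\mathfrak F^{\mathrm{env}}_M(\omega)=\sum_{l=1}^M|F_l(\omega)|^2$ and let $\omega_1>\dots>\omega_m$ be the frequencies of $C$ in $B=[\omega^*-W,\omega^*+W]$. For $M\ge m$, Filter Diagonalization forms the $M\times M$ matrices $$(V_M^2)_{sl}=\int_{-T}^{T}\!\int_{-T}^{T}e^{-i\omega^*(\tau-t)}\overline{f_s(\tau)}f_l(t)\,C(\tau-t)\,dt\,d\tau,$$ $$(H_{V_M})_{sl}=i\int_{-T}^{T}\!\int_{-T}^{T}e^{-i\omega^*(\tau-t)}\overline{f_s(\tau)}f_l(t)\,\partial_tC(\tau-t)\,dt\,d\tau,$$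 takes a matrix $U_m$ whose columns are orthonormal eigenvectors of $V_M^2$ for its $m$ largest eigenvalues, and returns the $m$ generalized eigenvalues $\tilde\omega_1\ge\dots\ge\tilde\omega_m$ of $U_m^\dagger H_{V_M}U_m\Phi=U_m^\dagger V_M^2U_m\Phi\,\mathrm{diag}(\tilde\omega)$ ($\Phi$ invertible). Let $$(N_M^2)_{sl}=\sum_{\omega_k\notin B}|a_k|^2\,\overline{F_s(\omega_k-\omega^*)}\,F_l(\omega_k-\omega^*)$$ be the noise Gram matrix (the sum runs over the frequencies of $C$ outside $B$), and let $\lambda_1(\cdot)\ge\lambda_2(\cdot)\ge\cdots$ be the eigenvalues of a Hermitian matrix in descending order. Then for all $k\in\{1,\dots,m\}$: 1. If all frequencies of $C$ lie in $[\omega_{\min},\omega_{\max}]$, then $$\frac{\lambda_1(N_M^2)}{\lambda_m(V_M^2)}(\omega_{\min}-\omega_k)\le\tilde\omega_k-\omega_k\le\frac{\lambda_1(N_M^2)}{\lambda_m(V_M^2)}(\omega_{\max}-\omega_k).$$ 2. If $\lambda_m(V_M^2)>(m+1)\lambda_1(N_M^2)$, then $$\frac{\sum_{\omega_l<\omega^*-W}(\omega_l-\omega_k)|a_l|^2\,\mathfrak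 F^{\mathrm{env}}_M(\omega_l-\omega^*)}{\lambda_m(V_M^2)-\lambda_1(N_M^2)}\le\tilde\omega_k-\omega_k\le\frac{\sum_{\omega_l>\omega^*+W}(\omega_l-\omega_k)|a_l|^2\,\mathfrak F^{\mathrm{env}}_M(\omega_l-\omega^*)}{\lambda_m(V_M^2)-\lambda_1(N_M^2)},$$ where the sums run over the frequencies $\omega_l$ of $C$ below and above the band, respectively. -/

import Mathlib

open MeasureTheory

noncomputable section

namespace FilterDiag

/-- A signal `C(t) = ∑ₖ |aₖ|² exp(i ωₖ t)` with finitely many pairwise distinct real frequencies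
`ωₖ`, each of which really occurs in the signal (`aₖ ≠ 0`). -/
structure Signal where
  /-- the number of frequencies -/
  N : ℕ
  /-- the frequencies `ωₖ` -/
  freq : Fin N → ℝ
  /-- the coefficients `aₖ` -/
  amp : Fin N → ℂ
  freq_injective : Function.Injective freq
  amp_ne_zero : ∀ k, amp k ≠ 0

/-- The value `C(t)` of the signal at time `t`. -/
def Signal.C (S : Signal) (t : ℝ) : ℂ :=
  ∑ k, ((‖S.amp k‖ ^ 2 : ℝ) : ℂ) * Complex.exp (Complex.I * (S.freq k : ℂ) * (t : ℂ))

/-- The Fourier transform `∫ f(t) exp(-iωt) dt` in the angular frequency convention. -/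
def fourierTransform (f : ℝ → ℂ) (ω : ℝ) : ℂ :=
  ∫ t : ℝ, f t * Complex.exp (-Complex.I * (ω : ℂ) * (t : ℂ))

/-- `F₀, F₁, …` is a complete Chebyshev system on `[-W, W]`: for every `n` and all pairwise distinct
points `w₁, …, wₙ` of `[-W, W]`, the alternant matrix of the first `n` functions is nonsingular. -/
def IsCompleteChebyshevSystem (W : ℝ) (F : ℕ → ℝ → ℂ) : Prop :=
  ∀ (n : ℕ) (w : Fin n → ℝ), Function.Injective w → (∀ i, w i ∈ Set.Icc (-W) W) →
    (Matrix.of fun i j : Fin n => F (j : ℕ) (w i)).det ≠ 0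

/-- A `W T`-filter system: square integrable functions `fₗ` that vanish (almost everywhere) outside
`[-T, T]`, whose Fourier transforms `Fₗ` form a complete Chebyshev system on `[-W, W]`. The
functions are numbered from `0`. -/
structure FilterSystem (T W : ℝ) where
  /-- the time duals `fₗ` -/
  f : ℕ → ℝ → ℂ
  memLp : ∀ l, MemLp (f l) 2 volume
  support : ∀ l, ∀ᵐ t : ℝ, t ∉ Set.Icc (-T) T → f l t = 0
  chebyshev : IsCompleteChebyshevSystem W fun l => fourierTransform (f l)

variable {T W : ℝ}

/-- The filter functions `Fₗ` in frequency space. -/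
def FilterSystem.F (Fs : FilterSystem T W) (l : ℕ) (ω : ℝ) : ℂ :=
  fourierTransform (Fs.f l) ω

/-- The filter envelope of degree `M`. -/
def FilterSystem.envelope (Fs : FilterSystem T W) (M : ℕ) (ω : ℝ) : ℝ :=
  ∑ l : Fin M, ‖Fs.F l ω‖ ^ 2

/-- The band `[ω⋆ - W, ω⋆ + W]`. -/
def band (W ωc : ℝ) : Set ℝ := Set.Icc (ωc - W) (ωc + W)

/-- The Gram matrix `V²` with filter centre `ωc`, computed from the signal in the time domain. -/
def gramMatrix (S : Signal) (Fs : FilterSystem T W) (ωc : ℝ) (M : ℕ) :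
    Matrix (Fin M) (Fin M) ℂ :=
  Matrix.of fun s l => ∫ τ in (-T)..T, ∫ t in (-T)..T,
    Complex.exp (-Complex.I * (ωc : ℂ) * ((τ : ℂ) - (t : ℂ))) *
      (starRingEnd ℂ) (Fs.f s τ) * Fs.f l t * S.C (τ - t)

/-- The projected operator `H_V` with filter centre `ωc`, computed from the signal in the time
domain. -/
def hamiltonianMatrix (S : Signal) (Fs : FilterSystem T W) (ωc : ℝ) (M : ℕ) :
    Matrix (Fin M) (Fin M) ℂ :=
  Matrix.of fun s l => Complex.I * ∫ τ in (-T)..T, ∫ t in (-T)..T,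
    Complex.exp (-Complex.I * (ωc : ℂ) * ((τ : ℂ) - (t : ℂ))) *
      (starRingEnd ℂ) (Fs.f s τ) * Fs.f l t * deriv (fun t' : ℝ => S.C (τ - t')) t

open Classical in
/-- The noise Gram matrix `N²`: the contribution to `V²` of the frequencies outside the band. -/
def noiseGramMatrix (S : Signal) (Fs : FilterSystem T W) (ωc : ℝ) (M : ℕ) :
    Matrix (Fin M) (Fin M) ℂ :=
  Matrix.of fun s l => ∑ k with S.freq k ∉ band W ωc,
    ((‖S.amp k‖ ^ 2 : ℝ) : ℂ) * (starRingEnd ℂ) (Fs.F s (S.freq k - ωc)) *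
      Fs.F l (S.freq k - ωc)

/-- The `j`-th largest eigenvalue `λⱼ(A)` of a Hermitian `M × M` matrix, counted with multiplicity,
for `1 ≤ j ≤ M` (and `0` for other `j`). -/
def eigenvalueDesc {M : ℕ} {A : Matrix (Fin M) (Fin M) ℂ} (hA : A.IsHermitian) (j : ℕ) : ℝ :=
  if h : 1 ≤ j ∧ j ≤ M then
    hA.eigenvalues₀ ⟨j - 1, by rw [Fintype.card_fin]; omega⟩
  else 0

/-- `ωt` is a list of frequencies returned by Filter Diagonalization for the pair `(H, V2)`, the
number `m` of wanted frequencies and the guess dimension `M ≥ m`: diagonalize `V2` by a unitary `U`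
with eigenvalues in descending order, keep the leading `m` columns `Uₘ` of `U`, and solve the
generalized eigenvalue problem `Uₘᴴ H Uₘ Φ = Uₘᴴ V2 Uₘ Φ Λ(ωt)`, with `Φ` a basis of generalized
eigenvectors. The returned frequencies are listed in descending order. -/
def IsOutput {M m : ℕ} (hmM : m ≤ M) (H V2 : Matrix (Fin M) (Fin M) ℂ) (ωt : Fin m → ℝ) : Prop :=
  Antitone ωt ∧
  ∃ U ∈ Matrix.unitaryGroup (Fin M) ℂ, ∃ lam : Fin M → ℝ, Antitone lam ∧
    U.conjTranspose * V2 * U = Matrix.diagonal (fun i => (lam i : ℂ)) ∧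
    ∃ Φ : Matrix (Fin m) (Fin m) ℂ, IsUnit Φ ∧
      let Um : Matrix (Fin M) (Fin m) ℂ := U.submatrix id (Fin.castLE hmM)
      (Um.conjTranspose * H * Um) * Φ =
        (Um.conjTranspose * V2 * Um) * Φ * Matrix.diagonal (fun i => (ωt i : ℂ))

/-- `ν₁ > ⋯ > νₘ` are exactly the frequencies of the signal in the band `[ωc - W, ωc + W]`. -/
def IsBandFrequencies (S : Signal) (W ωc : ℝ) {m : ℕ} (ν : Fin m → ℝ) : Prop :=
  StrictAnti ν ∧ Set.range ν = Set.range S.freq ∩ band W ωc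

theorem noiseGramMatrix_isHermitian (S : Signal) (Fs : FilterSystem T W) (ωc : ℝ) (M : ℕ) :
    (noiseGramMatrix S Fs ωc M).IsHermitian := by
  ext s l
  simp only [noiseGramMatrix, Matrix.conjTranspose_apply, Matrix.of_apply, star_sum]
  refine Finset.sum_congr rfl fun k _ => ?_
  simp only [RCLike.star_def, map_mul, Complex.conj_ofReal, Complex.conj_conj]
  ring

/-- The frequency representation of the time domain double integrals. -/
theorem integral_gram (f g : ℝ → ℂ) (hf : IntervalIntegrable f volume (-T) T)
    (hg : IntervalIntegrable g volume (-T) T) (ωc : ℝ) {n : ℕ} (c : Fin n → ℂ) (w : Fin n → ℝ) :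
    (∫ τ in (-T)..T, ∫ t in (-T)..T,
      Complex.exp (-Complex.I * (ωc : ℂ) * ((τ : ℂ) - (t : ℂ))) * (starRingEnd ℂ) (f τ) * g t *
        ∑ k, c k * Complex.exp (Complex.I * (w k : ℂ) * ((τ - t : ℝ) : ℂ))) =
    ∑ k, c k *
      (starRingEnd ℂ) (∫ τ in (-T)..T,
        f τ * Complex.exp (-Complex.I * ((w k - ωc : ℝ) : ℂ) * (τ : ℂ))) *
      ∫ t in (-T)..T, g t * Complex.exp (-Complex.I * ((w k - ωc : ℝ) : ℂ) * (t : ℂ)) := by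
  have key : ∀ τ t : ℝ,
      Complex.exp (-Complex.I * (ωc : ℂ) * ((τ : ℂ) - (t : ℂ))) * (starRingEnd ℂ) (f τ) * g t *
        ∑ k, c k * Complex.exp (Complex.I * (w k : ℂ) * ((τ - t : ℝ) : ℂ)) =
      ∑ k, (c k * (starRingEnd ℂ)
          (f τ * Complex.exp (-Complex.I * ((w k - ωc : ℝ) : ℂ) * (τ : ℂ)))) *
        (g t * Complex.exp (-Complex.I * ((w k - ωc : ℝ) : ℂ) * (t : ℂ))) := by
    intro τ t
    rw [Finset.mul_sum]
    refine Finset.sum_congr rfl fun k _ => ?_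
    rw [map_mul, ← Complex.exp_conj]
    simp only [map_mul, map_neg, Complex.conj_I, Complex.conj_ofReal, neg_neg]
    have : Complex.exp (-Complex.I * (ωc : ℂ) * ((τ : ℂ) - (t : ℂ))) *
        Complex.exp (Complex.I * (w k : ℂ) * ((τ - t : ℝ) : ℂ)) =
        Complex.exp (Complex.I * ((w k - ωc : ℝ) : ℂ) * (τ : ℂ)) *
        Complex.exp (-Complex.I * ((w k - ωc : ℝ) : ℂ) * (t : ℂ)) := by
      rw [← Complex.exp_add, ← Complex.exp_add]
      congr 1
      push_cast
      ring
    linear_combination (starRingEnd ℂ) (f τ) * g t * c k * this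
  have hint : ∀ (h : ℝ → ℂ) (_ : IntervalIntegrable h volume (-T) T) (v : ℝ),
      IntervalIntegrable (fun t => h t * Complex.exp (-Complex.I * (v : ℂ) * (t : ℂ)))
        volume (-T) T := fun h hh v =>
    hh.mul_continuousOn (by fun_prop)
  simp only [key]
  have inner : ∀ τ : ℝ, (∫ t in (-T)..T, ∑ k, (c k * (starRingEnd ℂ)
          (f τ * Complex.exp (-Complex.I * ((w k - ωc : ℝ) : ℂ) * (τ : ℂ)))) *
        (g t * Complex.exp (-Complex.I * ((w k - ωc : ℝ) : ℂ) * (t : ℂ)))) =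
      ∑ k, (c k * ∫ t in (-T)..T,
          g t * Complex.exp (-Complex.I * ((w k - ωc : ℝ) : ℂ) * (t : ℂ))) *
        (starRingEnd ℂ) (f τ * Complex.exp (-Complex.I * ((w k - ωc : ℝ) : ℂ) * (τ : ℂ))) := by
    intro τ
    rw [intervalIntegral.integral_finsetSum fun k _ => (hint g hg _).const_mul _]
    refine Finset.sum_congr rfl fun k _ => ?_
    rw [intervalIntegral.integral_const_mul]
    ring
  simp only [inner]
  have hconj : ∀ k, IntervalIntegrable (fun τ : ℝ => (starRingEnd ℂ)
      (f τ * Complex.exp (-Complex.I * ((w k - ωc : ℝ) : ℂ) * (τ : ℂ)))) volume (-T) T :=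
    fun k => ⟨Complex.conjCLE.toContinuousLinearMap.integrable_comp (hint f hf _).1,
      Complex.conjCLE.toContinuousLinearMap.integrable_comp (hint f hf _).2⟩
  rw [intervalIntegral.integral_finsetSum fun k _ => (hconj k).const_mul _]
  refine Finset.sum_congr rfl fun k _ => ?_
  rw [intervalIntegral.integral_const_mul]
  have : (∫ τ in (-T)..T, (starRingEnd ℂ)
      (f τ * Complex.exp (-Complex.I * ((w k - ωc : ℝ) : ℂ) * (τ : ℂ)))) =
      (starRingEnd ℂ) (∫ τ in (-T)..T,
        f τ * Complex.exp (-Complex.I * ((w k - ωc : ℝ) : ℂ) * (τ : ℂ))) := by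
    simp only [intervalIntegral, integral_conj, map_sub]
  rw [this]
  ring

theorem FilterSystem.intervalIntegrable (Fs : FilterSystem T W) (l : ℕ) :
    IntervalIntegrable (Fs.f l) volume (-T) T := by
  rw [intervalIntegrable_iff]
  haveI : IsFiniteMeasure (volume.restrict (Set.uIoc (-T) T)) :=
    ⟨by rw [Measure.restrict_apply_univ, Set.uIoc]; exact measure_Ioc_lt_top⟩
  exact ((Fs.memLp l).restrict _).integrable (by norm_num)

theorem gramMatrix_isHermitian (S : Signal) (Fs : FilterSystem T W) (ωc : ℝ) (M : ℕ) :
    (gramMatrix S Fs ωc M).IsHermitian := by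
  ext s l
  simp only [gramMatrix, Matrix.conjTranspose_apply, Matrix.of_apply, Signal.C]
  rw [integral_gram _ _ (Fs.intervalIntegrable _) (Fs.intervalIntegrable _),
    integral_gram _ _ (Fs.intervalIntegrable _) (Fs.intervalIntegrable _), star_sum]
  refine Finset.sum_congr rfl fun k _ => ?_
  simp only [RCLike.star_def, map_mul, Complex.conj_ofReal, Complex.conj_conj]
  ring

/-- The `j`-th largest eigenvalue `λⱼ(V²)` of the Gram matrix. -/
def gramEigenvalue (S : Signal) (Fs : FilterSystem T W) (ωc : ℝ) (M j : ℕ) : ℝ :=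
  eigenvalueDesc (gramMatrix_isHermitian S Fs ωc M) j

/-- The `j`-th largest eigenvalue `λⱼ(N²)` of the noise Gram matrix. -/
def noiseEigenvalue (S : Signal) (Fs : FilterSystem T W) (ωc : ℝ) (M j : ℕ) : ℝ :=
  eigenvalueDesc (noiseGramMatrix_isHermitian S Fs ωc M) j

end FilterDiag

end

namespace FilterDiag

open Matrix
open scoped ComplexOrder

/-! In frequency space `V²` and `H` are sums over the same rank-one forms, with weights `|a_l|²` and
`ω_l |a_l|²`. Hence `H - μ V²` has quadratic form `Σ (ω_l - μ) |a_l|² |v_l ⬝ y|²`, where `v_l` holds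
the filter values at `ω_l`.

To bound `ωt k - ν k` above, combine the first `k` generalized eigenvectors into some `y ≠ 0` that
annihilates the band frequencies above `ν k` (`exists_pencil_vector`). The form at `μ = ωt k` is
then nonnegative, so `(ωt k - ν k) · ⟨y, V² y⟩ ≤ Σ (ω_l - ν k) |a_l|² |v_l ⬝ y|²`. On the right no
band frequency contributes positively, so only noise remains; on the left `⟨y, V² y⟩ ≥ λ_m ‖y‖²`,
because `y` lies in the span of the leading eigenvectors. The Chebyshev property gives `λ_m > 0`. A
sign `s = ±1` treats both directions at once (`signed_error_le`). The two claims estimate the noise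
by `λ₁(N²)` and by Cauchy–Schwarz respectively. -/

/-! ### Hermitian definite pencils -/

/-- A square homogeneous linear system in which one equation is vacuous has a nonzero solution. -/
theorem exists_ne_zero_of_linear_conditions {m : ℕ} (L : Fin m → (Fin m → ℂ) →ₗ[ℂ] ℂ) (k : Fin m) :
    ∃ c ≠ 0, ∀ i, i ≠ k → L i c = 0 := by
  -- With row `k` zeroed, the image misses the `k`-th basis vector; a non-surjective endomorphism in
  -- finite dimension is not injective.
  let φ : (Fin m → ℂ) →ₗ[ℂ] (Fin m → ℂ) := LinearMap.pi fun i => if i = k then 0 else L i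
  have hns : ¬ Function.Injective φ := by
    rw [LinearMap.injective_iff_surjective]
    intro hs
    obtain ⟨c, hc⟩ := hs (Pi.single k 1)
    have := congrFun hc k
    simp [φ] at this
  have hker : ∃ c, φ c = 0 ∧ c ≠ 0 := by
    by_contra! h
    exact hns ((injective_iff_map_eq_zero φ).2 h)
  obtain ⟨c, hc, hc0⟩ := hker
  refine ⟨c, hc0, fun i hi => ?_⟩
  have := congrFun hc i
  simpa [φ, hi] using this

theorem star_dotProduct_self_eq {n : Type*} [Fintype n] (y : n → ℂ) :
    star y ⬝ᵥ y = ((∑ i, ‖y i‖ ^ 2 : ℝ) : ℂ) := by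
  simp [dotProduct, Complex.conj_mul']

theorem star_dotProduct_diagonal_mulVec {n : Type*} [Fintype n] [DecidableEq n]
    (d : n → ℝ) (y : n → ℂ) :
    star y ⬝ᵥ (diagonal (fun i => (d i : ℂ)) *ᵥ y) = ((∑ i, d i * ‖y i‖ ^ 2 : ℝ) : ℂ) := by
  simp only [dotProduct, mulVec_diagonal, Pi.star_apply, RCLike.star_def, Complex.ofReal_sum]
  refine Finset.sum_congr rfl fun i _ => ?_
  push_cast
  rw [← Complex.conj_mul']
  ring

theorem star_mulVec_dotProduct_mulVec {n p : Type*} [Fintype n] [Fintype p]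
    (B : Matrix n p ℂ) (A : Matrix n n ℂ) (x : p → ℂ) :
    star (B *ᵥ x) ⬝ᵥ (A *ᵥ (B *ᵥ x)) = star x ⬝ᵥ ((Bᴴ * A * B) *ᵥ x) := by
  rw [star_mulVec, ← dotProduct_mulVec, mulVec_mulVec, mulVec_mulVec, Matrix.mul_assoc]

/-- A Courant–Fischer type selection principle for a Hermitian definite generalized eigenvalue
problem: among the combinations of the eigenvectors with indices in `J ∪ {k}` there is a nonzero
one annihilated by the functionals with indices in `J`. -/
theorem exists_pencil_vector {m : ℕ} {A D Φ : Matrix (Fin m) (Fin m) ℂ} {ωt : Fin m → ℝ}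
    (hA : A.IsHermitian) (hD : D.PosSemidef) (hΦ : IsUnit Φ)
    (h : A * Φ = D * Φ * diagonal (fun i => (ωt i : ℂ)))
    (L : Fin m → (Fin m → ℂ) →ₗ[ℂ] ℂ) (k : Fin m) (J : Set (Fin m)) (hkJ : k ∉ J) (s : ℝ)
    (hs : ∀ j ∈ J, 0 ≤ s * (ωt j - ωt k)) :
    ∃ x ≠ 0, (∀ i ∈ J, L i x = 0) ∧
      0 ≤ s * ((star x ⬝ᵥ (A *ᵥ x)).re - ωt k * (star x ⬝ᵥ (D *ᵥ x)).re) := by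
  classical
  -- The conditions with index in `J` kill the functionals; the others force `c` to be supported in
  -- `J ∪ {k}`.
  obtain ⟨c, hc0, hc⟩ := exists_ne_zero_of_linear_conditions
    (fun i => if i ∈ J then (L i).comp Φ.mulVecLin else LinearMap.proj i) k
  have hcJ : ∀ i, i ∉ J → i ≠ k → c i = 0 := fun i hi hik => by simpa [hi] using hc i hik
  refine ⟨Φ *ᵥ c, ?_, fun i hi => ?_, ?_⟩
  · intro h0
    exact hc0 (Matrix.mulVec_injective_of_isUnit hΦ (by rw [h0, mulVec_zero]))
  · simpa [hi] using hc i (fun h => hkJ (h ▸ hi))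
  have hP : (Φᴴ * D * Φ).PosSemidef := hD.conjTranspose_mul_mul_same Φ
  set P := Φᴴ * D * Φ with hPdef
  have hAP : Φᴴ * A * Φ = P * diagonal (fun i => (ωt i : ℂ)) := by
    rw [Matrix.mul_assoc, h, hPdef]
    simp only [Matrix.mul_assoc]
  -- `Φᴴ A Φ = P Λ` is Hermitian, so `P` commutes with `Λ` and couples only equal eigenvalues. This
  -- replaces any orthogonality of the columns of `Φ`.
  have hcomm : ∀ i j, P i j * ωt j = ωt i * P i j := by
    have h1 : (P * diagonal (fun i => (ωt i : ℂ)))ᴴ = P * diagonal (fun i => (ωt i : ℂ)) := by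
      rw [← hAP]
      simp only [conjTranspose_mul, conjTranspose_conjTranspose, hA.eq, Matrix.mul_assoc]
    rw [conjTranspose_mul, hP.1.eq, diagonal_conjTranspose] at h1
    intro i j
    have := congrFun (congrFun h1 i) j
    simpa [mul_diagonal, diagonal_mul] using this.symm
  -- Absorbing the weights into `c` turns the form into `star d ⬝ᵥ (P *ᵥ d) ≥ 0`. A negative
  -- radicand would give the default root `0`, but it occurs only where `c i = 0`.
  let r : Fin m → ℝ := fun i => √(s * (ωt i - ωt k))
  let d : Fin m → ℂ := fun i => r i * c i
  have hkey : star d ⬝ᵥ (P *ᵥ d) =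
      s * (star c ⬝ᵥ ((P * diagonal (fun i => (ωt i : ℂ))) *ᵥ c) - ωt k * star c ⬝ᵥ (P *ᵥ c)) := by
    simp only [dotProduct, mulVec, Finset.mul_sum, ← Finset.sum_sub_distrib, mul_diagonal,
      Pi.star_apply, RCLike.star_def]
    refine Finset.sum_congr rfl fun i _ => Finset.sum_congr rfl fun j _ => ?_
    by_cases hz : P i j = 0
    · simp [hz]
    have hij : ωt i = ωt j := by
      have := hcomm i j
      rw [mul_comm] at this
      exact_mod_cast (mul_right_cancel₀ hz this).symm
    have hr : r i = r j := by simp [r, hij]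
    by_cases hci : c j = 0
    · simp [d, hci]
    have hj : 0 ≤ s * (ωt j - ωt k) := by
      by_cases hjk : j = k
      · simp [hjk]
      · by_cases hjJ : j ∈ J
        · exact hs j hjJ
        · exact absurd (hcJ j hjJ hjk) hci
    have hrr : (r j : ℂ) * r j = s * (ωt j - ωt k) := by
      have := Real.mul_self_sqrt hj
      exact_mod_cast this
    simp only [d, map_mul, Complex.conj_ofReal, hr]
    linear_combination (starRingEnd ℂ) (c i) * P i j * c j * hrr
  rw [star_mulVec_dotProduct_mulVec, star_mulVec_dotProduct_mulVec, ← hPdef, hAP]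
  have h0 := hP.re_dotProduct_nonneg d
  rw [hkey] at h0
  simpa using h0

/-! ### Eigenvalues in descending order -/

/-- The largest eigenvalue bounds the quadratic form of a Hermitian matrix. -/
theorem re_quadraticForm_le_eigenvalueDesc {M : ℕ} {A : Matrix (Fin M) (Fin M) ℂ}
    (hA : A.IsHermitian) (hM : 1 ≤ M) (y : Fin M → ℂ) :
    (star y ⬝ᵥ (A *ᵥ y)).re ≤ eigenvalueDesc hA 1 * ∑ i, ‖y i‖ ^ 2 := by
  set U := (hA.eigenvectorUnitary : Matrix (Fin M) (Fin M) ℂ)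
  have hUU : U * Uᴴ = 1 := Unitary.coe_mul_star_self hA.eigenvectorUnitary
  have hA' : Uᴴ * A * U = diagonal (fun i => (hA.eigenvalues i : ℂ)) := by
    have := hA.conjStarAlgAut_star_eigenvectorUnitary
    rw [Unitary.conjStarAlgAut_star_apply] at this
    exact this
  have hy : y = U *ᵥ (Uᴴ *ᵥ y) := by rw [mulVec_mulVec, hUU, one_mulVec]
  set z := Uᴴ *ᵥ y
  have hle : ∀ i, hA.eigenvalues i ≤ eigenvalueDesc hA 1 := fun i => by
    rw [eigenvalueDesc, dif_pos ⟨le_rfl, hM⟩]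
    exact hA.eigenvalues₀_antitone (Fin.mk_le_of_le_val (Nat.zero_le _))
  have hnorm : ∑ i, ‖y i‖ ^ 2 = ∑ i, ‖z i‖ ^ 2 := by
    have h1 : star z ⬝ᵥ z = star y ⬝ᵥ y := by
      rw [star_mulVec, conjTranspose_conjTranspose, ← dotProduct_mulVec, ← hy]
    rw [star_dotProduct_self_eq, star_dotProduct_self_eq] at h1
    exact_mod_cast h1.symm
  rw [hnorm, hy, star_mulVec_dotProduct_mulVec, hA', star_dotProduct_diagonal_mulVec,
    Complex.ofReal_re, Finset.mul_sum]
  exact Finset.sum_le_sum fun i _ => mul_le_mul_of_nonneg_right (hle i) (by positivity)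

/-- The diagonal of a unitary diagonalization in descending order consists of the eigenvalues in
descending order. -/
theorem eigenvalueDesc_eq_of_diagonalization {M : ℕ} {A U : Matrix (Fin M) (Fin M) ℂ}
    (hA : A.IsHermitian) (hU : U ∈ unitaryGroup (Fin M) ℂ) {lam : Fin M → ℝ} (hlam : Antitone lam)
    (h : Uᴴ * A * U = diagonal (fun i => (lam i : ℂ))) (i : Fin M) :
    eigenvalueDesc hA (i + 1) = lam i := by
  have hUU : U * Uᴴ = 1 := mem_unitaryGroup_iff.1 hU
  -- Both lists are the sorted roots of the same characteristic polynomial, so multiplicities agree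
  -- as well.
  have hchar : A.charpoly = (diagonal (fun i => (lam i : ℂ))).charpoly := by
    rw [← h, charpoly_mul_comm, ← Matrix.mul_assoc, hUU, Matrix.one_mul]
  have hroots : A.charpoly.roots = Multiset.map (fun i => (lam i : ℂ)) Finset.univ.val := by
    rw [hchar, charpoly_diagonal, Polynomial.roots_prod]
    · simp
    · simp [Finset.prod_ne_zero_iff, Polynomial.X_sub_C_ne_zero]
  have hsort := hA.sort_roots_charpoly_eq_eigenvalues₀
  have hsort' : (A.charpoly.roots.map RCLike.re).sort (· ≥ ·) = List.ofFn lam := by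
    simp_rw [hroots, Fin.univ_val_map, Multiset.map_coe, List.map_ofFn, Function.comp_def,
      RCLike.re_eq_complex_re, Complex.ofReal_re, Multiset.coe_sort]
    apply List.mergeSort_of_pairwise
    simp_rw [decide_eq_true_eq, ← List.sortedGE_iff_pairwise]
    exact hlam.sortedGE_ofFn
  rw [hsort'] at hsort
  rw [eigenvalueDesc, dif_pos ⟨by omega, by omega⟩]
  have := congrArg (fun l => l[(i : ℕ)]?) hsort
  simp only [List.getElem?_ofFn] at this
  simpa using this.symm

/-! ### Frequency representation of the matrices -/

variable {T W : ℝ}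

/-- The Gram type matrix `∑ₖ cₖ uₖ⋆ᵀ uₖ` of a finite family of row vectors. -/
noncomputable def weightedGram {ι : Type*} {M : ℕ} (K : Finset ι) (c : ι → ℝ) (u : ι → Fin M → ℂ) :
    Matrix (Fin M) (Fin M) ℂ :=
  Matrix.of fun s l => ∑ k ∈ K, (c k : ℂ) * (starRingEnd ℂ) (u k s) * u k l

theorem star_dotProduct_weightedGram_mulVec {ι : Type*} {M : ℕ} (K : Finset ι) (c : ι → ℝ)
    (u : ι → Fin M → ℂ) (y : Fin M → ℂ) :
    star y ⬝ᵥ (weightedGram K c u *ᵥ y) = ((∑ k ∈ K, c k * ‖u k ⬝ᵥ y‖ ^ 2 : ℝ) : ℂ) := by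
  have h : ∀ k, ((c k * ‖u k ⬝ᵥ y‖ ^ 2 : ℝ) : ℂ) =
      ∑ s, ∑ l, star (y s) * ((c k : ℂ) * (starRingEnd ℂ) (u k s) * u k l * y l) := by
    intro k
    push_cast
    rw [← Complex.conj_mul', dotProduct, map_sum, Finset.sum_mul_sum, Finset.mul_sum]
    refine Finset.sum_congr rfl fun s _ => ?_
    rw [Finset.mul_sum]
    refine Finset.sum_congr rfl fun l _ => ?_
    rw [map_mul, RCLike.star_def]
    ring
  rw [Complex.ofReal_sum, Finset.sum_congr rfl fun k _ => h k]
  simp only [dotProduct, mulVec, weightedGram, Matrix.of_apply, Finset.sum_mul, Finset.mul_sum,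
    Pi.star_apply]
  rw [Finset.sum_comm]
  rw [Finset.sum_congr rfl fun k _ => Finset.sum_comm, Finset.sum_comm]
  refine Finset.sum_congr rfl fun s _ => ?_
  rw [Finset.sum_comm]

theorem weightedGram_isHermitian {ι : Type*} {M : ℕ} (K : Finset ι) (c : ι → ℝ)
    (u : ι → Fin M → ℂ) : (weightedGram K c u).IsHermitian := by
  ext s l
  simp only [weightedGram, Matrix.conjTranspose_apply, Matrix.of_apply, star_sum]
  refine Finset.sum_congr rfl fun k _ => ?_
  simp only [RCLike.star_def, map_mul, Complex.conj_ofReal, Complex.conj_conj]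
  ring

/-- The Cauchy–Schwarz inequality for the bilinear dot product. -/
theorem norm_dotProduct_sq_le {n : Type*} [Fintype n] (u y : n → ℂ) :
    ‖u ⬝ᵥ y‖ ^ 2 ≤ (∑ i, ‖u i‖ ^ 2) * ∑ i, ‖y i‖ ^ 2 := by
  refine le_trans ?_ (Finset.sum_mul_sq_le_sq_mul_sq Finset.univ (fun i => ‖u i‖) fun i => ‖y i‖)
  gcongr
  refine (norm_sum_le _ _).trans_eq ?_
  simp

/-- The vector `(F_s(ω - ωc))_s` of the values of the filter functions at a frequency. -/
noncomputable def FilterSystem.values (Fs : FilterSystem T W) (ωc : ℝ) (M : ℕ) (ω : ℝ) : Fin M → ℂ :=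
  fun s => Fs.F s (ω - ωc)

theorem FilterSystem.F_eq_intervalIntegral (Fs : FilterSystem T W) (hT : 0 < T) (l : ℕ) (ω : ℝ) :
    Fs.F l ω = ∫ t in (-T)..T, Fs.f l t * Complex.exp (-Complex.I * (ω : ℂ) * (t : ℂ)) := by
  rw [intervalIntegral.integral_of_le (by linarith), ← integral_Icc_eq_integral_Ioc,
    setIntegral_eq_integral_of_ae_compl_eq_zero]
  · rfl
  · filter_upwards [Fs.support l] with t ht h
    rw [ht h, zero_mul]

theorem gramMatrix_eq_weightedGram (S : Signal) (Fs : FilterSystem T W) (hT : 0 < T) (ωc : ℝ)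
    (M : ℕ) : gramMatrix S Fs ωc M =
      weightedGram Finset.univ (fun k => ‖S.amp k‖ ^ 2) fun k => Fs.values ωc M (S.freq k) := by
  ext s l
  simp only [gramMatrix, weightedGram, Matrix.of_apply, Signal.C, FilterSystem.values]
  rw [integral_gram _ _ (Fs.intervalIntegrable _) (Fs.intervalIntegrable _)]
  simp only [Fs.F_eq_intervalIntegral hT]

theorem Signal.deriv_C_sub (S : Signal) (τ t : ℝ) :
    deriv (fun t' : ℝ => S.C (τ - t')) t =
      ∑ k, (-Complex.I * ((S.freq k * ‖S.amp k‖ ^ 2 : ℝ) : ℂ)) *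
        Complex.exp (Complex.I * (S.freq k : ℂ) * ((τ - t : ℝ) : ℂ)) := by
  have h1 : HasDerivAt (fun t' : ℝ => ((τ - t' : ℝ) : ℂ)) (-1) t := by
    simpa using ((hasDerivAt_id t).const_sub τ).ofReal_comp
  refine HasDerivAt.deriv (HasDerivAt.fun_sum fun k _ => ?_)
  refine (((h1.const_mul (Complex.I * (S.freq k : ℂ))).cexp).const_mul
    ((‖S.amp k‖ ^ 2 : ℝ) : ℂ)).congr_deriv ?_
  push_cast
  ring

/-- Differentiating `C(τ - t)` in `t` produces `-i ω_k`, which the prefactor `i` turns into the real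
weight `ω_k`. The vectors are those of `gramMatrix_eq_weightedGram`, so the two forms can be
compared term by term. -/
theorem hamiltonianMatrix_eq_weightedGram (S : Signal) (Fs : FilterSystem T W) (hT : 0 < T)
    (ωc : ℝ) (M : ℕ) : hamiltonianMatrix S Fs ωc M =
      weightedGram Finset.univ (fun k => S.freq k * ‖S.amp k‖ ^ 2)
        fun k => Fs.values ωc M (S.freq k) := by
  ext s l
  simp only [hamiltonianMatrix, weightedGram, Matrix.of_apply, Signal.deriv_C_sub,
    FilterSystem.values]
  rw [integral_gram _ _ (Fs.intervalIntegrable _) (Fs.intervalIntegrable _), Finset.mul_sum]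
  simp only [Fs.F_eq_intervalIntegral hT]
  refine Finset.sum_congr rfl fun k _ => ?_
  linear_combination (-((S.freq k * ‖S.amp k‖ ^ 2 : ℝ) : ℂ) *
    (starRingEnd ℂ) (∫ τ in (-T)..T,
        Fs.f s τ * Complex.exp (-Complex.I * ((S.freq k - ωc : ℝ) : ℂ) * (τ : ℂ))) *
      ∫ t in (-T)..T, Fs.f l t * Complex.exp (-Complex.I * ((S.freq k - ωc : ℝ) : ℂ) * (t : ℂ))) *
    Complex.I_mul_I

open Classical in
theorem sum_noise_le_noiseEigenvalue (S : Signal) (Fs : FilterSystem T W) (ωc : ℝ) {M : ℕ}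
    (hM : 1 ≤ M) (y : Fin M → ℂ) :
    ∑ l with S.freq l ∉ band W ωc, ‖S.amp l‖ ^ 2 * ‖Fs.values ωc M (S.freq l) ⬝ᵥ y‖ ^ 2 ≤
      noiseEigenvalue S Fs ωc M 1 * ∑ i, ‖y i‖ ^ 2 := by
  refine le_trans (le_of_eq ?_)
    (re_quadraticForm_le_eigenvalueDesc (noiseGramMatrix_isHermitian S Fs ωc M) hM y)
  rw [show noiseGramMatrix S Fs ωc M =
      weightedGram {k | S.freq k ∉ band W ωc} (fun k => ‖S.amp k‖ ^ 2)
        (fun k => Fs.values ωc M (S.freq k)) from rfl,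
    star_dotProduct_weightedGram_mulVec, Complex.ofReal_re]

/-! ### Positivity from the Chebyshev property -/

/-- The value vectors of the filter functions at distinct frequencies of the band are linearly
independent. -/
theorem FilterSystem.sum_mul_values_ne_zero (Fs : FilterSystem T W) {ωc : ℝ} {m M : ℕ}
    (hmM : m ≤ M) {ν : Fin m → ℝ} (hν : Function.Injective ν) (hband : ∀ i, ν i ∈ band W ωc)
    {β : Fin m → ℂ} (hβ : β ≠ 0) : (fun s => ∑ i, β i * Fs.values ωc M (ν i) s) ≠ 0 := by
  intro h
  have hdet := Fs.chebyshev m (fun i => ν i - ωc) (fun i j hij => hν (by simpa using hij))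
    (fun i => by
      have := hband i
      rw [band, Set.mem_Icc] at this
      rw [Set.mem_Icc]
      constructor <;> linarith [this.1, this.2])
  refine hβ (Matrix.eq_zero_of_vecMul_eq_zero hdet ?_)
  -- The first `m` of the `M` components already form the nonsingular alternant.
  ext j
  exact congrFun h (Fin.castLE hmM j)

/-- The `m`-th eigenvalue of the Gram matrix is positive. -/
theorem gramMatrix_diagonalization_pos (S : Signal) (Fs : FilterSystem T W) (hT : 0 < T) {ωc : ℝ}
    {m M : ℕ} (hmM : m ≤ M) {ν : Fin m → ℝ} (hν : IsBandFrequencies S W ωc ν)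
    {U : Matrix (Fin M) (Fin M) ℂ} (hU : U ∈ unitaryGroup (Fin M) ℂ) {lam : Fin M → ℝ}
    (hlam : Antitone lam)
    (h : Uᴴ * gramMatrix S Fs ωc M * U = diagonal (fun i => (lam i : ℂ))) (k : Fin m) :
    0 < lam (Fin.castLE hmM k) := by
  by_contra! hneg
  have hband : ∀ i, ν i ∈ Set.range S.freq ∩ band W ωc := fun i => hν.2 ▸ Set.mem_range_self i
  -- The columns are conjugated so that `Bᴴ *ᵥ y` lists the products of the value vectors with `y`.
  let B : Matrix (Fin M) (Fin m) ℂ :=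
    Matrix.of fun s i => (starRingEnd ℂ) (Fs.values ωc M (ν i) s)
  -- Eigencoordinates of `y` before `k` vanish, and from `k` on the eigenvalues are `≤ 0`. So the
  -- Gram form is `≤ 0` at `y`.
  obtain ⟨β, hβ, hβk⟩ := exists_ne_zero_of_linear_conditions
    (fun i => (LinearMap.proj (Fin.castLE hmM i)).comp (Uᴴ * B).mulVecLin) k
  have hUU : U * Uᴴ = 1 := mem_unitaryGroup_iff.1 hU
  set y := B *ᵥ β with hy
  set z := Uᴴ *ᵥ y with hz
  have hz0 : ∀ i : Fin m, i ≠ k → z (Fin.castLE hmM i) = 0 := fun i hi => by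
    simpa [hz, hy, mulVec_mulVec] using hβk i hi
  have hyz : y = U *ᵥ z := by rw [hz, mulVec_mulVec, hUU, one_mulVec]
  have hle : ∑ l, ‖S.amp l‖ ^ 2 * ‖Fs.values ωc M (S.freq l) ⬝ᵥ y‖ ^ 2 ≤ 0 := by
    have h1 := star_mulVec_dotProduct_mulVec U (gramMatrix S Fs ωc M) z
    rw [h, star_dotProduct_diagonal_mulVec, ← hyz, gramMatrix_eq_weightedGram S Fs hT,
      star_dotProduct_weightedGram_mulVec, Complex.ofReal_inj] at h1
    rw [h1]
    refine Finset.sum_nonpos fun i _ => ?_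
    by_cases hi : (i : ℕ) < k
    · have := hz0 ⟨i, hi.trans k.2⟩ (fun h => by simp [← h] at hi)
      have h2 : z i = 0 := this
      simp [h2]
    · exact mul_nonpos_of_nonpos_of_nonneg
        ((hlam (show Fin.castLE hmM k ≤ i from not_lt.1 hi)).trans hneg) (by positivity)
  have hzero : ∀ l, Fs.values ωc M (S.freq l) ⬝ᵥ y = 0 := fun l => by
    have h1 := (Finset.sum_eq_zero_iff_of_nonneg fun l _ => by positivity).1
      (le_antisymm hle (Finset.sum_nonneg fun l _ => by positivity)) l (Finset.mem_univ l)
    simpa [S.amp_ne_zero l] using h1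
  have hBy : Bᴴ *ᵥ y = 0 := by
    ext i
    obtain ⟨l, hl⟩ := (hband i).1
    have := hzero l
    rw [hl] at this
    simpa [B, mulVec, conjTranspose_apply, dotProduct] using this
  -- `y` lies in the range of `B` and in the kernel of `Bᴴ`, which are orthogonal.
  have hy0 : y = 0 := by
    rw [← dotProduct_star_self_eq_zero, hy, star_mulVec, ← dotProduct_mulVec,
      ← hy, hBy, dotProduct_zero]
  refine Fs.sum_mul_values_ne_zero hmM hν.1.injective (fun i => (hband i).2)
    (β := star β) (star_ne_zero.2 hβ) ?_
  ext s
  have := congrArg (starRingEnd ℂ) (congrFun hy0 s)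
  simpa [hy, B, mulVec, dotProduct, mul_comm] using this

/-! ### The test vector and the error bounds -/

/-- The vector underlying all error bounds. For `s = 1` (`s = -1`) it is orthogonal to the wanted
frequencies above (below) the `k`-th one. -/
theorem exists_output_vector (S : Signal) (Fs : FilterSystem T W) (hT : 0 < T) {ωc : ℝ}
    {m M : ℕ} (hmM : m ≤ M) {ν : Fin m → ℝ} (hν : IsBandFrequencies S W ωc ν)
    {ωt : Fin m → ℝ}
    (hωt : IsOutput hmM (hamiltonianMatrix S Fs ωc M) (gramMatrix S Fs ωc M) ωt) (k : Fin m)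
    (s : ℝ) (J : Set (Fin m)) (hkJ : k ∉ J) (hJ : ∀ i ∈ J, 0 ≤ s * (ωt i - ωt k)) :
    0 < gramEigenvalue S Fs ωc M m ∧ ∃ y : Fin M → ℂ, 0 < ∑ i, ‖y i‖ ^ 2 ∧
      (∀ i ∈ J, Fs.values ωc M (ν i) ⬝ᵥ y = 0) ∧
      gramEigenvalue S Fs ωc M m * ∑ i, ‖y i‖ ^ 2 ≤
        ∑ l, ‖S.amp l‖ ^ 2 * ‖Fs.values ωc M (S.freq l) ⬝ᵥ y‖ ^ 2 ∧
      0 ≤ s * ∑ l, (S.freq l - ωt k) * ‖S.amp l‖ ^ 2 *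
        ‖Fs.values ωc M (S.freq l) ⬝ᵥ y‖ ^ 2 := by
  obtain ⟨-, U, hU, lam, hlam, hdiag, Φ, hΦ, hpencil⟩ := hωt
  set Um : Matrix (Fin M) (Fin m) ℂ := U.submatrix id (Fin.castLE hmM) with hUm
  have hm : 1 ≤ m := by have := k.2; omega
  let last : Fin m := ⟨m - 1, by omega⟩
  have hlast : ∀ i : Fin m, i ≤ last := fun i => Fin.mk_le_of_le_val (by simp only [last]; omega)
  -- `gramEigenvalue` counts from `1` and `lam` from `0`, so `λ_m` sits at index `m - 1`.
  have hgram : gramEigenvalue S Fs ωc M m = lam (Fin.castLE hmM last) := by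
    rw [gramEigenvalue, ← eigenvalueDesc_eq_of_diagonalization (gramMatrix_isHermitian S Fs ωc M)
      hU hlam hdiag]
    congr 1
    simp only [Fin.val_castLE, last]
    omega
  have hpos : 0 < gramEigenvalue S Fs ωc M m :=
    hgram ▸ gramMatrix_diagonalization_pos S Fs hT hmM hν hU hlam hdiag last
  refine ⟨hpos, ?_⟩
  have hD : Umᴴ * gramMatrix S Fs ωc M * Um =
      diagonal (fun i => (lam (Fin.castLE hmM i) : ℂ)) := by
    have h1 : Umᴴ * gramMatrix S Fs ωc M * Um =
        (Uᴴ * gramMatrix S Fs ωc M * U).submatrix (Fin.castLE hmM) (Fin.castLE hmM) := by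
      ext i j
      simp [hUm, Matrix.mul_apply]
    rw [h1, hdiag, submatrix_diagonal _ _ (Fin.castLE_injective hmM)]
    rfl
  have hUmUm : Umᴴ * Um = 1 := by
    have h1 : Umᴴ * Um = (Uᴴ * U).submatrix (Fin.castLE hmM) (Fin.castLE hmM) := by
      ext i j
      simp [hUm, Matrix.mul_apply]
    rw [h1, show Uᴴ * U = 1 from mem_unitaryGroup_iff'.1 hU,
      submatrix_one _ (Fin.castLE_injective hmM)]
  have hlow : ∀ i : Fin m, gramEigenvalue S Fs ωc M m ≤ lam (Fin.castLE hmM i) := fun i =>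
    hgram ▸ hlam (show Fin.castLE hmM i ≤ Fin.castLE hmM last from hlast i)
  have hHh : (hamiltonianMatrix S Fs ωc M).IsHermitian := by
    rw [hamiltonianMatrix_eq_weightedGram S Fs hT]
    exact weightedGram_isHermitian _ _ _
  have hA : (Umᴴ * hamiltonianMatrix S Fs ωc M * Um).IsHermitian :=
    isHermitian_conjTranspose_mul_mul Um hHh
  have hDpsd : (Umᴴ * gramMatrix S Fs ωc M * Um).PosSemidef := by
    rw [hD, posSemidef_diagonal_iff]
    exact fun i => by exact_mod_cast hpos.le.trans (hlow i)
  obtain ⟨x, hx0, hxL, hx⟩ := exists_pencil_vector hA hDpsd hΦ hpencil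
    (fun i => (dotProductBilin ℂ ℂ (Fs.values ωc M (ν i))).comp Um.mulVecLin) k J hkJ s hJ
  have hnorm : ∑ i, ‖(Um *ᵥ x) i‖ ^ 2 = ∑ i, ‖x i‖ ^ 2 := by
    have h1 : star (Um *ᵥ x) ⬝ᵥ (Um *ᵥ x) = star x ⬝ᵥ x := by
      rw [star_mulVec, ← dotProduct_mulVec, mulVec_mulVec, hUmUm, one_mulVec]
    rw [star_dotProduct_self_eq, star_dotProduct_self_eq] at h1
    exact_mod_cast h1
  refine ⟨Um *ᵥ x, ?_, fun i hi => ?_, ?_, ?_⟩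
  · rw [hnorm]
    obtain ⟨i, hi⟩ := Function.ne_iff.1 hx0
    exact Finset.sum_pos' (fun _ _ => by positivity)
      ⟨i, Finset.mem_univ i, by have : x i ≠ 0 := hi; positivity⟩
  · simpa using hxL i hi
  · have h1 := star_mulVec_dotProduct_mulVec Um (gramMatrix S Fs ωc M) x
    rw [hD, star_dotProduct_diagonal_mulVec, gramMatrix_eq_weightedGram S Fs hT,
      star_dotProduct_weightedGram_mulVec, Complex.ofReal_inj] at h1
    rw [h1, hnorm, Finset.mul_sum]
    exact Finset.sum_le_sum fun i _ => mul_le_mul_of_nonneg_right (hlow i) (by positivity)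
  · rw [← star_mulVec_dotProduct_mulVec, ← star_mulVec_dotProduct_mulVec,
      gramMatrix_eq_weightedGram S Fs hT, hamiltonianMatrix_eq_weightedGram S Fs hT,
      star_dotProduct_weightedGram_mulVec, star_dotProduct_weightedGram_mulVec,
      Complex.ofReal_re, Complex.ofReal_re, Finset.mul_sum, ← Finset.sum_sub_distrib] at hx
    refine hx.trans_eq (congrArg _ (Finset.sum_congr rfl fun l _ => ?_))
    ring

/-- A bound of the signed error of the `k`-th output frequency, upwards for `s = 1` and downwards
for `s = -1`, from a bound of the quadratic form of `s (H - νₖ V²)` on all vectors for which no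
frequency of the band contributes positively. -/
theorem signed_error_le (S : Signal) (Fs : FilterSystem T W) (hT : 0 < T) {ωc : ℝ}
    {m M : ℕ} (hmM : m ≤ M) {ν : Fin m → ℝ} (hν : IsBandFrequencies S W ωc ν)
    {ωt : Fin m → ℝ}
    (hωt : IsOutput hmM (hamiltonianMatrix S Fs ωc M) (gramMatrix S Fs ωc M) ωt) (k : Fin m)
    (s R : ℝ) (hR0 : 0 ≤ R)
    (hR : ∀ y : Fin M → ℂ, (∀ l, S.freq l ∈ band W ωc →
        s * (S.freq l - ν k) * ‖Fs.values ωc M (S.freq l) ⬝ᵥ y‖ ^ 2 ≤ 0) →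
      ∑ l, s * (S.freq l - ν k) * ‖S.amp l‖ ^ 2 * ‖Fs.values ωc M (S.freq l) ⬝ᵥ y‖ ^ 2 ≤
        R * ∑ i, ‖y i‖ ^ 2) :
    s * (ωt k - ν k) ≤ R / gramEigenvalue S Fs ωc M m := by
  -- `J` collects the band frequencies that would contribute positively. Both `ν` and `ωt` are
  -- listed in descending order, so the sign of `s * (ν i - ν k)` passes to `s * (ωt i - ωt k)` in
  -- the weak sense.
  obtain ⟨hpos, y, hy, hyJ, hyG, hyH⟩ := exists_output_vector S Fs hT hmM hν hωt k s
    {i | 0 < s * (ν i - ν k)} (by simp) (fun i hi => by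
      have hi : 0 < s * (ν i - ν k) := hi
      rcases lt_trichotomy i k with h | h | h
      · have h1 := hν.1 h
        have h2 := hωt.1 h.le
        have : 0 < s := by
          by_contra! hs
          nlinarith
        exact mul_nonneg this.le (by linarith)
      · simp [h]
      · have h1 := hν.1 h
        have h2 := hωt.1 h.le
        have : s ≤ 0 := by
          by_contra! hs
          nlinarith
        exact mul_nonneg_of_nonpos_of_nonpos this (by linarith))
  have hb := hR y fun l hl => by
    obtain ⟨i, hi⟩ : S.freq l ∈ Set.range ν := hν.2 ▸ ⟨Set.mem_range_self l, hl⟩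
    by_cases hs : 0 < s * (ν i - ν k)
    · rw [← hi, hyJ i hs]
      simp
    · rw [← hi]
      exact mul_nonpos_of_nonpos_of_nonneg (not_lt.1 hs) (by positivity)
  set n := ∑ i, ‖y i‖ ^ 2
  set G := ∑ l, ‖S.amp l‖ ^ 2 * ‖Fs.values ωc M (S.freq l) ⬝ᵥ y‖ ^ 2 with hG
  have hsplit : s * ∑ l, (S.freq l - ωt k) * ‖S.amp l‖ ^ 2 *
      ‖Fs.values ωc M (S.freq l) ⬝ᵥ y‖ ^ 2 =
      (∑ l, s * (S.freq l - ν k) * ‖S.amp l‖ ^ 2 * ‖Fs.values ωc M (S.freq l) ⬝ᵥ y‖ ^ 2) -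
        s * (ωt k - ν k) * G := by
    rw [hG, Finset.mul_sum, Finset.mul_sum, ← Finset.sum_sub_distrib]
    exact Finset.sum_congr rfl fun l _ => by ring
  rw [hsplit] at hyH
  rw [le_div_iff₀ hpos]
  have h1 : s * (ωt k - ν k) * G ≤ R * n := by linarith
  -- The lower bound on `G` helps only for a positive signed error; otherwise `R ≥ 0` suffices.
  rcases le_or_gt (s * (ωt k - ν k)) 0 with h | h
  · exact (mul_nonpos_of_nonpos_of_nonneg h hpos.le).trans hR0
  · refine le_of_mul_le_mul_right ?_ hy
    rw [mul_assoc]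
    exact (mul_le_mul_of_nonneg_left hyG h.le).trans h1

/-- The noise form is a sum of nonnegative terms, and `λ₁(N²)` dominates its value at a unit vector.
-/
theorem noiseEigenvalue_one_nonneg (S : Signal) (Fs : FilterSystem T W) (ωc : ℝ) {M : ℕ}
    (hM : 1 ≤ M) : 0 ≤ noiseEigenvalue S Fs ωc M 1 := by
  classical
  have h := sum_noise_le_noiseEigenvalue S Fs ωc hM (Pi.single ⟨0, hM⟩ 1)
  have h1 : ∑ i, ‖(Pi.single ⟨0, hM⟩ 1 : Fin M → ℂ) i‖ ^ 2 = 1 := by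
    rw [Finset.sum_eq_single ⟨0, hM⟩] <;> simp +contextual
  rw [h1, mul_one] at h
  exact (Finset.sum_nonneg fun _ _ => by positivity).trans h

/-- The error bound in terms of the noise eigenvalue and the largest signed distance `d` of a
frequency of the signal from `νₖ`. -/
theorem signed_error_le_noise (S : Signal) (Fs : FilterSystem T W) (hT : 0 < T) {ωc : ℝ}
    {m M : ℕ} (hmM : m ≤ M) {ν : Fin m → ℝ} (hν : IsBandFrequencies S W ωc ν)
    {ωt : Fin m → ℝ}
    (hωt : IsOutput hmM (hamiltonianMatrix S Fs ωc M) (gramMatrix S Fs ωc M) ωt) (k : Fin m)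
    (s d : ℝ) (hd : ∀ l, s * (S.freq l - ν k) ≤ d) :
    s * (ωt k - ν k) ≤ noiseEigenvalue S Fs ωc M 1 * d / gramEigenvalue S Fs ωc M m := by
  classical
  have hM : 1 ≤ M := by have := k.2; omega
  -- `ν k` is itself a signal frequency, at signed distance `0`.
  have hd0 : 0 ≤ d := by
    obtain ⟨l, hl⟩ : ν k ∈ Set.range S.freq := (hν.2 ▸ Set.mem_range_self k :
      ν k ∈ Set.range S.freq ∩ band W ωc).1
    simpa [hl] using hd l
  refine signed_error_le S Fs hT hmM hν hωt k s _
    (mul_nonneg (noiseEigenvalue_one_nonneg S Fs ωc hM) hd0) fun y hy => ?_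
  calc _ ≤ ∑ l, if S.freq l ∉ band W ωc then
        d * (‖S.amp l‖ ^ 2 * ‖Fs.values ωc M (S.freq l) ⬝ᵥ y‖ ^ 2) else 0 := by
        refine Finset.sum_le_sum fun l _ => ?_
        by_cases hl : S.freq l ∈ band W ωc
        · rw [if_neg (not_not.2 hl), mul_right_comm]
          exact mul_nonpos_of_nonpos_of_nonneg (hy l hl) (by positivity)
        · rw [if_pos hl, mul_assoc]
          exact mul_le_mul_of_nonneg_right (hd l) (by positivity)
    _ = d * ∑ l with S.freq l ∉ band W ωc,
        ‖S.amp l‖ ^ 2 * ‖Fs.values ωc M (S.freq l) ⬝ᵥ y‖ ^ 2 := by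
        rw [← Finset.sum_filter, Finset.mul_sum]
    _ ≤ d * (noiseEigenvalue S Fs ωc M 1 * ∑ i, ‖y i‖ ^ 2) :=
        mul_le_mul_of_nonneg_left (sum_noise_le_noiseEigenvalue S Fs ωc hM y) hd0
    _ = _ := by ring

/-- The error bound in terms of the filter envelope at the frequencies `K` outside the band on the
side `s` of `νₖ`. -/
theorem signed_error_le_envelope (S : Signal) (Fs : FilterSystem T W) (hT : 0 < T) {ωc : ℝ}
    {m M : ℕ} (hmM : m ≤ M) {ν : Fin m → ℝ} (hν : IsBandFrequencies S W ωc ν)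
    {ωt : Fin m → ℝ}
    (hωt : IsOutput hmM (hamiltonianMatrix S Fs ωc M) (gramMatrix S Fs ωc M) ωt) (k : Fin m)
    (s : ℝ) (K : Finset (Fin S.N)) (hK : ∀ l ∈ K, 0 ≤ s * (S.freq l - ν k))
    (hKc : ∀ l ∉ K, S.freq l ∈ band W ωc ∨ s * (S.freq l - ν k) ≤ 0)
    (hgap : noiseEigenvalue S Fs ωc M 1 < gramEigenvalue S Fs ωc M m) :
    s * (ωt k - ν k) ≤
      (∑ l ∈ K, s * (S.freq l - ν k) * ‖S.amp l‖ ^ 2 * Fs.envelope M (S.freq l - ωc)) /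
        (gramEigenvalue S Fs ωc M m - noiseEigenvalue S Fs ωc M 1) := by
  classical
  have hM : 1 ≤ M := by have := k.2; omega
  have hE : ∀ ω, 0 ≤ Fs.envelope M ω := fun ω => Finset.sum_nonneg fun _ _ => by positivity
  have hR0 : 0 ≤ ∑ l ∈ K,
      s * (S.freq l - ν k) * ‖S.amp l‖ ^ 2 * Fs.envelope M (S.freq l - ωc) :=
    Finset.sum_nonneg fun l hl => mul_nonneg (mul_nonneg (hK l hl) (by positivity)) (hE _)
  -- The argument yields the sharper denominator `λ_m(V²)`; subtracting `λ₁(N²) ≥ 0` only weakens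
  -- the bound.
  refine (signed_error_le S Fs hT hmM hν hωt k s _ hR0 fun y hy => ?_).trans
    (div_le_div_of_nonneg_left hR0 (by linarith)
      (by linarith [noiseEigenvalue_one_nonneg S Fs ωc hM]))
  rw [Finset.sum_mul, ← Finset.sum_add_sum_compl K]
  refine (add_le_of_nonpos_right (Finset.sum_nonpos fun l hl => ?_)).trans
    (Finset.sum_le_sum fun l hl => ?_)
  · rcases hKc l (Finset.mem_compl.1 hl) with h | h
    · rw [mul_right_comm]
      exact mul_nonpos_of_nonpos_of_nonneg (hy l h) (by positivity)
    · exact mul_nonpos_of_nonpos_of_nonneg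
        (mul_nonpos_of_nonpos_of_nonneg h (by positivity)) (by positivity)
  · rw [mul_assoc _ (Fs.envelope M _)]
    exact mul_le_mul_of_nonneg_left (norm_dotProduct_sq_le _ y)
      (mul_nonneg (hK l hl) (by positivity))

end FilterDiag

/-! ### The two-sided bounds, with `s = -1` for the lower and `s = 1` for the upper -/

theorem mainTheorem10 (S : FilterDiag.Signal) (T W : ℝ) (hT : 0 < T) (hW : 0 < W)
    (Fs : FilterDiag.FilterSystem T W) (ωc : ℝ)
    (m : ℕ) (ν : Fin m → ℝ) (hν : FilterDiag.IsBandFrequencies S W ωc ν)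
    (M : ℕ) (hmM : m ≤ M) (ωt : Fin m → ℝ)
    (hωt : FilterDiag.IsOutput hmM (FilterDiag.hamiltonianMatrix S Fs ωc M)
      (FilterDiag.gramMatrix S Fs ωc M) ωt) :
    (∀ ωmin ωmax : ℝ, (∀ l, S.freq l ∈ Set.Icc ωmin ωmax) → ∀ k : Fin m,
      FilterDiag.noiseEigenvalue S Fs ωc M 1 / FilterDiag.gramEigenvalue S Fs ωc M m *
          (ωmin - ν k) ≤ ωt k - ν k ∧
      ωt k - ν k ≤
        FilterDiag.noiseEigenvalue S Fs ωc M 1 / FilterDiag.gramEigenvalue S Fs ωc M m *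
          (ωmax - ν k)) ∧
    (FilterDiag.gramEigenvalue S Fs ωc M m >
        ((m : ℝ) + 1) * FilterDiag.noiseEigenvalue S Fs ωc M 1 → ∀ k : Fin m,
      (∑ l with S.freq l < ωc - W,
          (S.freq l - ν k) * ‖S.amp l‖ ^ 2 * Fs.envelope M (S.freq l - ωc)) /
          (FilterDiag.gramEigenvalue S Fs ωc M m - FilterDiag.noiseEigenvalue S Fs ωc M 1)
        ≤ ωt k - ν k ∧
      ωt k - ν k ≤
        (∑ l with ωc + W < S.freq l,
          (S.freq l - ν k) * ‖S.amp l‖ ^ 2 * Fs.envelope M (S.freq l - ωc)) /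
          (FilterDiag.gramEigenvalue S Fs ωc M m - FilterDiag.noiseEigenvalue S Fs ωc M 1)) := by

  refine ⟨fun ωmin ωmax hω k => ⟨?_, ?_⟩, fun hgap k => ?_⟩
  · have h := FilterDiag.signed_error_le_noise S Fs hT hmM hν hωt k (-1) (ν k - ωmin)
      fun l => by linarith [(hω l).1]
    have h' : FilterDiag.noiseEigenvalue S Fs ωc M 1 / FilterDiag.gramEigenvalue S Fs ωc M m *
        (ωmin - ν k) = -(FilterDiag.noiseEigenvalue S Fs ωc M 1 * (ν k - ωmin) /
          FilterDiag.gramEigenvalue S Fs ωc M m) := by ring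
    linarith
  · have h := FilterDiag.signed_error_le_noise S Fs hT hmM hν hωt k 1 (ωmax - ν k)
      fun l => by linarith [(hω l).2]
    rwa [one_mul, mul_div_right_comm] at h
  have hband : ν k ∈ FilterDiag.band W ωc :=
    (hν.2 ▸ Set.mem_range_self k : ν k ∈ Set.range S.freq ∩ FilterDiag.band W ωc).2
  rw [FilterDiag.band, Set.mem_Icc] at hband
  -- Since `λ₁(N²) ≥ 0`, the factor `m + 1` yields the plain gap that makes the denominator
  -- positive.
  have hgap' : FilterDiag.noiseEigenvalue S Fs ωc M 1 < FilterDiag.gramEigenvalue S Fs ωc M m := by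
    have hN := FilterDiag.noiseEigenvalue_one_nonneg S Fs ωc (M := M) (by have := k.2; omega)
    have : 0 ≤ (m : ℝ) * FilterDiag.noiseEigenvalue S Fs ωc M 1 := by positivity
    linarith
  constructor
  · have h := FilterDiag.signed_error_le_envelope S Fs hT hmM hν hωt k (-1)
      {l | S.freq l < ωc - W}
      (fun l hl => by
        have := (Finset.mem_filter.1 hl).2
        linarith [hband.1])
      (fun l hl => by
        have h1 : ωc - W ≤ S.freq l := by simpa using hl
        rcases le_or_gt (S.freq l) (ωc + W) with h2 | h2
        · exact Or.inl ⟨h1, h2⟩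
        -- A frequency beyond the opposite edge of the band pulls the error the other way, so it
        -- drops out of this bound.
        · exact Or.inr (by linarith [hband.2])) hgap'
    simp only [neg_mul, one_mul, Finset.sum_neg_distrib, neg_div] at h
    linarith
  · have h := FilterDiag.signed_error_le_envelope S Fs hT hmM hν hωt k 1
      {l | ωc + W < S.freq l}
      (fun l hl => by
        have := (Finset.mem_filter.1 hl).2
        linarith [hband.2])
      (fun l hl => by
        have h1 : S.freq l ≤ ωc + W := by simpa using hl
        rcases le_or_gt (ωc - W) (S.freq l) with h2 | h2
        · exact Or.inl ⟨h2, h1⟩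
        · exact Or.inr (by linarith [hband.1])) hgap'
    simpa only [one_mul] using h
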